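/- Let $G=(V,E,L)$ be a finite graph with loops, where $E$ consists of edges joining two distinct nodes and the loop set is partitioned as $L=L^+\cup L^-$ into plus loops and minus loops. More generally, a hypergraph with loops is a triple $H=(V_H,E_H,L_H)$, where $V_H$ is a finite set, $E_H$ is a set of subsets of $V_H$ of cardinality at least two, and $L_H=L_H^+\cup L_H^-$ is a partitioned set of loops $\{i,i\}$, $i\in V_H$. Let $$\mathrm{PP}(H):=\mathrm{conv}\Big\{z\in\mathbb R^{V_H\cup E_H\cup L_H}:\ z_{ii}\ge z_i^2\ \forall \{i,i\}\in L_H^+,\ z_{ii}\le z_i^2\ \forall\{i,i\}\in L_H^-,\ z_e=\prod_{i\in e}z_i\ \forall e\in E_H,\ z_i\in[0,1]\ \forall i\in V_H\Big\},$$ and write $\mathrm{QP}(G)$ for this set when $H=G$ is a graph. An extended formulation of a convex set $C\subseteq\mathbb R^n$ is a convex set $Q\subseteq\mathbb R^{n+r}$, $r\ge 0$, with $C=\{x: \exists y,\ (x,y)\in Q\}$. Let $V^+:=\{i\in V:\{i,i\}\in L^+\}$, let $V_c$, $c\in\mathcal C$, be the node sets of the connected components of the subgraph of $G$ induced by $V^+$,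 and let $N(V_c):=\{i\in V\setminus V_c: \{i,j\}\in E\text{ for some }j\in V_c\}$. **Proposition.** There are hypergraphs with loops $G'_c$, $c\in\mathcal C\cup\{0\}$, such that: 1. for each $c\in\mathcal C$, $G'_c$ has node set $V_c\cup N(V_c)$, hence $|V_c|+|N(V_c)|$ nodes; its plus loops are those at the nodes of $V_c$, so that there are $|V_c|$ of them; its minus loops are the minus loops of $G$ at its nodes; 2. $G'_0$ has node set $V\setminus V^+$, hence $|V|-\sum_{c\in\mathcal C}|V_c|$ nodes; it has no plus loops, and its minus loops are those of $G$; 3. every node, edge and loop of $G$ is a node, edge or loop, respectively, of some $G'_c$, $c\in\mathcal C\cup\{0\}$, and $\mathrm{QP}(G)$ has an extended formulation obtained by putting together formulations of the $\mathrm{PP}(G'_c)$. That is, for every choice of extended formulations $Q_c$ of $\mathrm{PP}(G'_c)$, $c\in\mathcal C\cup\{0\}$, with $r_c\ge 0$ additional variables $y_c$, the set of all $(w,(y_c)_c)$ with $$\big(w|_{G'_c},\,y_c\big)\in Q_c\quad\text{for all }c\in\mathcal C\cup\{0\}$$ is an extended formulation of $\mathrm{QP}(G)$. Here $w$ has one coordinate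 for each node, edge and loop occurring in some $G'_c$, and $w|_{G'_c}$ is its restriction to the coordinates of $G'_c$. -/

import Mathlib

/-- Names of the lifted variables over the node type `V`: `z_i` for a node `i`, `z_e` for an
edge `e`, and `z_ii` for a loop `{i, i}`. -/
inductive LiftedVar (V : Type*) where
  | node (i : V) : LiftedVar V
  | edge (e : Finset V) : LiftedVar V
  | loop (i : V) : LiftedVar V

/-- A hypergraph with loops `(nodes, edges, L⁻ ∪ L⁺)`, whose nodes are taken from `V`.
Loops are recorded by the node that carries them. -/
structure LoopHypergraph (V : Type*) where
  nodes : Finset V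
  edges : Set (Finset V)
  plus : Finset V
  minus : Finset V
  edge_subset : ∀ e ∈ edges, e ⊆ nodes
  two_le_card : ∀ e ∈ edges, 2 ≤ e.card
  plus_subset : plus ⊆ nodes
  minus_subset : minus ⊆ nodes
  disjoint : Disjoint plus minus

namespace LoopHypergraph

variable {V : Type*} (G : LoopHypergraph V)

/-- The index set `nodes ∪ edges ∪ loops` of the space in which `PP` lives. -/
def vars : Set (LiftedVar V) :=
  {p | match p with
    | .node i => i ∈ G.nodes
    | .edge e => e ∈ G.edges
    | .loop i => i ∈ G.plus ∨ i ∈ G.minus}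

def nodeVar (i : V) (hi : i ∈ G.nodes) : G.vars := ⟨.node i, hi⟩

def edgeVar (e : Finset V) (he : e ∈ G.edges) : G.vars := ⟨.edge e, he⟩

def plusVar (i : V) (hi : i ∈ G.plus) : G.vars := ⟨.loop i, Or.inl hi⟩

def minusVar (i : V) (hi : i ∈ G.minus) : G.vars := ⟨.loop i, Or.inr hi⟩

/-- The convex set `PP(G)` of a hypergraph with loops. -/
def PP : Set (G.vars → ℝ) :=
  convexHull ℝ {z |
    (∀ (i : V) (hi : i ∈ G.plus),
      z (G.nodeVar i (G.plus_subset hi)) ^ 2 ≤ z (G.plusVar i hi)) ∧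
    (∀ (i : V) (hi : i ∈ G.minus),
      z (G.minusVar i hi) ≤ z (G.nodeVar i (G.minus_subset hi)) ^ 2) ∧
    (∀ (e : Finset V) (he : e ∈ G.edges),
      z (G.edgeVar e he) = ∏ i ∈ e.attach, z (G.nodeVar i.1 (G.edge_subset e he i.2))) ∧
    (∀ (i : V) (hi : i ∈ G.nodes), z (G.nodeVar i hi) ∈ Set.Icc (0 : ℝ) 1)}

end LoopHypergraph

/-- A graph `G = (V, E, L)` with plus loops and minus loops on the node set `V`. -/
structure LoopGraph (V : Type*) where
  graph : SimpleGraph V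
  plus : Finset V
  minus : Finset V
  disjoint : Disjoint plus minus

namespace LoopGraph

variable {V : Type*} [Fintype V] [DecidableEq V] (G : LoopGraph V)

/-- A graph with loops, seen as a hypergraph whose edges are the sets `{i, j}`. -/
def toHypergraph : LoopHypergraph V where
  nodes := Finset.univ
  edges := {e | ∃ i j, G.graph.Adj i j ∧ e = {i, j}}
  plus := G.plus
  minus := G.minus
  edge_subset := fun e _ => Finset.subset_univ e
  two_le_card := by
    rintro e ⟨i, j, hij, rfl⟩
    exact (Finset.card_pair hij.ne).ge
  plus_subset := Finset.subset_univ _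
  minus_subset := Finset.subset_univ _
  disjoint := G.disjoint

/-- The index set `V ∪ E ∪ L` of the space in which `QP(G)` lives. -/
def vars : Set (LiftedVar V) := G.toHypergraph.vars

/-- The convex set `QP(G)` of a graph with loops. -/
def QP : Set (G.vars → ℝ) :=
  convexHull ℝ {z : G.vars → ℝ |
    (∀ (i : V) (hi : i ∈ G.plus),
      z (G.toHypergraph.nodeVar i (Finset.mem_univ i)) ^ 2 ≤
        z (G.toHypergraph.plusVar i hi)) ∧
    (∀ (i : V) (hi : i ∈ G.minus),
      z (G.toHypergraph.minusVar i hi) ≤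
        z (G.toHypergraph.nodeVar i (Finset.mem_univ i)) ^ 2) ∧
    (∀ (i j : V) (hij : G.graph.Adj i j),
      z (G.toHypergraph.edgeVar {i, j} ⟨i, j, hij, rfl⟩) =
        z (G.toHypergraph.nodeVar i (Finset.mem_univ i)) *
          z (G.toHypergraph.nodeVar j (Finset.mem_univ j))) ∧
    (∀ i : V, z (G.toHypergraph.nodeVar i (Finset.mem_univ i)) ∈ Set.Icc (0 : ℝ) 1)}

/-- The index set of the connected components of the subgraph induced by the plus-loop nodes. -/
abbrev PlusComponent : Type _ := (G.graph.induce (G.plus : Set V)).ConnectedComponent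

/-- The node set `V_c` of the component `c`. -/
def compNodes (c : G.PlusComponent) : Set V := Subtype.val '' c.supp

/-- The nodes outside `S` that are adjacent to some node of `S`. -/
def neighborhood (S : Set V) : Set V := {i | i ∉ S ∧ ∃ j ∈ S, G.graph.Adj i j}

end LoopGraph

/-- `Q` is an extended formulation of `C`: a convex set in the space with coordinates `κ`, which
include (through `f`) the coordinates `ι` of `C`, whose projection onto these is `C`. -/
def IsExtendedFormulation {ι κ : Type*} (f : ι ↪ κ) (Q : Set (κ → ℝ)) (C : Set (ι → ℝ)) : Prop :=
  Convex ℝ Q ∧ C = {x | ∃ w ∈ Q, ∀ i, w (f i) = x i}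

/-- The system obtained by putting together the systems `Q c`, where `Q c` has the variables of
`H c` and `r c` further variables of its own. Variables of different `H c` with the same name
(the same node, edge or loop) are one variable of the combined system, while the further
variables are kept apart. -/
def putTogether {V I : Type*} (H : I → LoopHypergraph V) (r : I → ℕ)
    (Q : ∀ c, Set ((H c).vars ⊕ Fin (r c) → ℝ)) :
    Set ((⋃ c, (H c).vars : Set (LiftedVar V)) ⊕ (Σ c, Fin (r c)) → ℝ) :=
  {w | ∀ c, (fun p : (H c).vars ⊕ Fin (r c) =>
    w (Sum.map (Set.inclusion (Set.subset_iUnion (fun c => (H c).vars) c)) (Sigma.mk c) p)) ∈ Q c}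

/-!
A node `i` without plus loop can be rounded: a feasible point with node value `u` and loop value
`t` is the mixture, with weights `1 - u` and `u`, of the feasible points with values `(0, t - u)`
and `(1, t - u + 1)`, the minus-loop constraint surviving because `t ≤ u ^ 2 ≤ u`. So every point
of `PP(H)` is a mixture, over the subsets `y` of the set `N` of nodes without plus loop, of points
rounded to the indicator function of `y`. If all subsets of `N` with at least two elements are
edges, then the value at the edge `T ⊆ N` is the total weight of the `y ⊇ T`, and by Möbius
inversion these values determine the weights.

In a component hypergraph `G'_c` the nodes without plus loop are the neighbours of `V_c`, and all
of them are nodes of `G'_0`. Points of the `PP(G'_c)` that agree on common variables therefore have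
weights that are marginals of the weights for `G'_0`. Once all nodes without plus loop are fixed to
`0` or `1`, distinct `G'_c` only share nodes with fixed values, and points of them can be combined
independently.
-/

section Mixtures

/-- The convex combinations of points of the sets `K i`, `i ∈ s`, with one point from each set.
For nonempty convex sets this is an explicit form of the convex hull of their union. -/
def mixtures (𝕜 : Type*) {E ι : Type*} [Semiring 𝕜] [PartialOrder 𝕜] [AddCommMonoid E]
    [Module 𝕜 E] (s : Finset ι) (K : ι → Set E) : Set E :=
  {x | ∃ (a : ι → 𝕜) (p : ι → E), (∀ i ∈ s, 0 ≤ a i) ∧ ∑ i ∈ s, a i = 1 ∧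
    (∀ i ∈ s, p i ∈ K i) ∧ ∑ i ∈ s, a i • p i = x}

theorem subset_mixtures {𝕜 E ι : Type*} [Semiring 𝕜] [PartialOrder 𝕜] [ZeroLEOneClass 𝕜]
    [AddCommMonoid E] [Module 𝕜 E] {s : Finset ι} {K : ι → Set E}
    (hK : ∀ i ∈ s, (K i).Nonempty) {i : ι} (hi : i ∈ s) : K i ⊆ mixtures 𝕜 s K := by
  classical
  intro x hx
  choose! q hq using hK
  have single_nonneg : (0 : ι → 𝕜) ≤ Pi.single i 1 := Pi.single_nonneg.2 zero_le_one
  refine ⟨Pi.single i 1, Function.update q i x, fun j _ => single_nonneg j, by simp [hi],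
    fun j hj => ?_, by simp [Pi.single_apply, hi]⟩
  rcases eq_or_ne j i with rfl | hji
  · simpa using hx
  · simpa [hji] using hq j hj

variable {𝕜 E ι : Type*} [Field 𝕜] [LinearOrder 𝕜] [IsStrictOrderedRing 𝕜] [AddCommGroup E]
  [Module 𝕜 E] {s : Finset ι} {K : ι → Set E}

theorem mixtures_subset {C : Set E} (hC : Convex 𝕜 C) (hK : ∀ i ∈ s, K i ⊆ C) :
    mixtures 𝕜 s K ⊆ C := by
  rintro _ ⟨a, p, ha, ha1, hp, rfl⟩
  exact hC.sum_mem ha ha1 fun i hi => hK i hi (hp i hi)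

open scoped Pointwise in
theorem convex_mixtures (hK : ∀ i ∈ s, Convex 𝕜 (K i)) : Convex 𝕜 (mixtures 𝕜 s K) := by
  rintro _ ⟨a, p, ha, ha1, hp, rfl⟩ _ ⟨a', p', ha', ha1', hp', rfl⟩ b b' hb hb' hbb'
  have exists_mean : ∀ i ∈ s, ∃ q ∈ K i,
      (b * a i + b' * a' i) • q = (b * a i) • p i + (b' * a' i) • p' i := by
    intro i hi
    rw [← Set.mem_smul_set, (hK i hi).add_smul (mul_nonneg hb (ha i hi))
      (mul_nonneg hb' (ha' i hi))]
    exact Set.add_mem_add (Set.smul_mem_smul_set (hp i hi)) (Set.smul_mem_smul_set (hp' i hi))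
  choose! q hq hq_mean using exists_mean
  refine ⟨fun i => b * a i + b' * a' i, q,
    fun i hi => add_nonneg (mul_nonneg hb (ha i hi)) (mul_nonneg hb' (ha' i hi)), ?_, hq, ?_⟩
  · rw [Finset.sum_add_distrib, ← Finset.mul_sum, ← Finset.mul_sum, ha1, ha1', mul_one, mul_one,
      hbb']
  · rw [Finset.sum_congr rfl hq_mean, Finset.sum_add_distrib]
    simp only [mul_smul, Finset.smul_sum]

theorem convexHull_biUnion_subset_mixtures (hK : ∀ i ∈ s, (K i).Nonempty) :
    convexHull 𝕜 (⋃ i ∈ s, K i) ⊆ mixtures 𝕜 s fun i => convexHull 𝕜 (K i) :=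
  convexHull_min
    (Set.iUnion₂_subset fun _ hi => (subset_convexHull 𝕜 _).trans
      (subset_mixtures (K := fun i => convexHull 𝕜 (K i)) (fun j hj => (hK j hj).convexHull) hi))
    (convex_mixtures fun i _ => convex_convexHull 𝕜 (K i))

end Mixtures

section MoebiusInversion

open Finset

theorem eq_of_forall_sum_Icc_eq {α M : Type*} [PartialOrder α] [LocallyFiniteOrder α]
    [AddCancelCommMonoid M] {f g : α → M} {b : α}
    (h : ∀ x ≤ b, ∑ y ∈ Icc x b, f y = ∑ y ∈ Icc x b, g y) {x : α} (hx : x ≤ b) :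
    f x = g x := by
  induction hn : #(Icc x b) using Nat.strong_induction_on generalizing x with
  | _ n ih =>
    have sum_Ioc_eq : ∑ y ∈ Ioc x b, f y = ∑ y ∈ Ioc x b, g y := by
      refine sum_congr rfl fun y hy => ?_
      obtain ⟨hxy, hyb⟩ := mem_Ioc.1 hy
      exact ih _ (hn ▸ card_lt_card (Icc_ssubset_Icc_left hx hxy le_rfl)) hyb rfl
    have sum_Icc_eq := h x hx
    rwa [← add_sum_Ioc_eq_sum_Icc hx, ← add_sum_Ioc_eq_sum_Icc hx, sum_Ioc_eq,
      add_left_inj] at sum_Icc_eq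

variable {V R M : Type*} [DecidableEq V] [Ring R] [AddCommMonoid M] [Module R M]
  {N B : Finset V} {a b : Finset V → R}

theorem eq_sum_inter_eq_of_sum_Icc_eq
    (h : ∀ T ⊆ N, ∑ y ∈ Icc T N, a y = ∑ x ∈ Icc T B, b x) {y : Finset V} (hy : y ⊆ N) :
    a y = ∑ x ∈ B.powerset with x ∩ N = y, b x := by
  refine eq_of_forall_sum_Icc_eq (g := fun y => ∑ x ∈ B.powerset with x ∩ N = y, b x)
    (fun T hT => ?_) hy
  have inter_mem : ∀ x ∈ Icc T B, x ∩ N ∈ Icc T N := fun x hx =>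
    mem_Icc.2 ⟨subset_inter (mem_Icc.1 hx).1 hT, inter_subset_right⟩
  rw [h T hT, ← sum_fiberwise_of_maps_to inter_mem]
  refine sum_congr rfl fun y hy => sum_congr ?_ fun _ _ => rfl
  ext x
  simp only [mem_filter, mem_Icc, mem_powerset]
  constructor
  · exact fun ⟨⟨_, hxB⟩, hxy⟩ => ⟨hxB, hxy⟩
  · rintro ⟨hxB, rfl⟩
    exact ⟨⟨(mem_Icc.1 hy).1.trans inter_subset_left, hxB⟩, rfl⟩

theorem sum_powerset_smul_eq_sum_powerset_smul_inter
    (h : ∀ T ⊆ N, ∑ y ∈ Icc T N, a y = ∑ x ∈ Icc T B, b x) (g : Finset V → M) :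
    ∑ y ∈ N.powerset, a y • g y = ∑ x ∈ B.powerset, b x • g (x ∩ N) := by
  have inter_mem : ∀ x ∈ B.powerset, x ∩ N ∈ N.powerset :=
    fun _ _ => mem_powerset.2 inter_subset_right
  rw [← sum_fiberwise_of_maps_to inter_mem]
  refine sum_congr rfl fun y hy => ?_
  rw [eq_sum_inter_eq_of_sum_Icc_eq h (mem_powerset.1 hy), sum_smul]
  exact sum_congr rfl fun x hx => by rw [(mem_filter.1 hx).2]

end MoebiusInversion

section ExtendedFormulation

theorem IsExtendedFormulation.trans {ι κ μ : Type*} {f : ι ↪ κ} {g : κ ↪ μ} {P : Set (κ → ℝ)}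
    {Q : Set (μ → ℝ)} {C : Set (ι → ℝ)} (hP : IsExtendedFormulation f P C)
    (hQ : IsExtendedFormulation g Q P) : IsExtendedFormulation (f.trans g) Q C := by
  refine ⟨hQ.1, hP.2.trans (Set.ext fun x => ⟨?_, ?_⟩)⟩
  · rintro ⟨z, hz, hzx⟩
    rw [hQ.2] at hz
    obtain ⟨w, hw, hwz⟩ := hz
    exact ⟨w, hw, fun i => (hwz (f i)).trans (hzx i)⟩
  · rintro ⟨w, hw, hwx⟩
    refine ⟨fun k => w (g k), ?_, hwx⟩
    rw [hQ.2]
    exact ⟨w, hw, fun _ => rfl⟩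

variable {V I : Type*} (H : I → LoopHypergraph V)

/-- The points with one coordinate for each variable of some `H c` whose restriction to the
variables of `H c` lies in `C c`, for every `c`. -/
def jointSet (C : ∀ c, Set ((H c).vars → ℝ)) : Set ((⋃ c, (H c).vars : Set (LiftedVar V)) → ℝ) :=
  {z | ∀ c, z ∘ Set.inclusion (Set.subset_iUnion (fun c => (H c).vars) c) ∈ C c}

variable {H} {C : ∀ c, Set ((H c).vars → ℝ)}

theorem convex_jointSet (hC : ∀ c, Convex ℝ (C c)) : Convex ℝ (jointSet H C) :=
  fun _ hz _ hz' _ _ hb hb' hbb' c => hC c (hz c) (hz' c) hb hb' hbb'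

theorem isExtendedFormulation_putTogether {r : I → ℕ} {Q : ∀ c, Set ((H c).vars ⊕ Fin (r c) → ℝ)}
    (hQ : ∀ c, IsExtendedFormulation Function.Embedding.inl (Q c) (C c)) :
    IsExtendedFormulation Function.Embedding.inl (putTogether H r Q) (jointSet H C) := by
  refine ⟨fun w hw w' hw' b b' hb hb' hbb' c => (hQ c).1 (hw c) (hw' c) hb hb' hbb',
    Set.ext fun z => ⟨fun hz => ?_, ?_⟩⟩
  · have exists_q : ∀ c, ∃ q ∈ Q c, ∀ v : (H c).vars,
        q (Sum.inl v) = z (Set.inclusion (Set.subset_iUnion (fun c => (H c).vars) c) v) := by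
      intro c
      have hzc := hz c
      rwa [(hQ c).2] at hzc
    choose q hqQ hqz using exists_q
    refine ⟨Sum.elim z fun k => q k.1 (Sum.inr k.2), fun c => ?_, fun _ => rfl⟩
    convert hqQ c using 1
    ext (v | k)
    · exact (hqz c v).symm
    · rfl
  · rintro ⟨w, hw, hwz⟩ c
    rw [(hQ c).2]
    exact ⟨_, hw c, fun v => hwz _⟩

end ExtendedFormulation

namespace LiftedVar

variable {V : Type*}

/-- The point with node values `u`, loop values `t`, and the products of the node values at all
finite sets of nodes. It has a coordinate for every conceivable variable, so that the points of
different hypergraphs live in one space. -/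
def lift (u t : V → ℝ) : LiftedVar V → ℝ
  | node i => u i
  | edge e => ∏ i ∈ e, u i
  | loop i => t i

theorem lift_eq_add_lift_update [DecidableEq V] (u t : V → ℝ) (i : V) :
    lift u t = (1 - u i) • lift (Function.update u i 0) (Function.update t i (t i - u i)) +
      u i • lift (Function.update u i 1) (Function.update t i (t i - u i + 1)) := by
  funext v
  simp only [Pi.add_apply, Pi.smul_apply, smul_eq_mul]
  cases v with
  | node j =>
    rcases eq_or_ne j i with rfl | hji
    · simp [lift]
    · simp only [lift, Function.update_of_ne hji]
      ring
  | edge e =>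
    by_cases hie : i ∈ e
    · simp only [lift, Finset.prod_update_of_mem hie]
      rw [← Finset.mul_prod_erase e u hie, Finset.sdiff_singleton_eq_erase]
      ring
    · simp only [lift, Finset.prod_update_of_notMem hie]
      ring
  | loop j =>
    rcases eq_or_ne j i with rfl | hji
    · simp only [lift, Function.update_self]
      ring
    · simp only [lift, Function.update_of_ne hji]
      ring

end LiftedVar

namespace LoopHypergraph

open LiftedVar

section PP

variable {V : Type*} (H : LoopHypergraph V)

/-- The loop and bound constraints of `PP H`, on node values `u` and loop values `t` that are
defined on all of `V`. The bounds are imposed outside the nodes of `H` as well. -/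
structure Feasible (u t : V → ℝ) : Prop where
  plus : ∀ i ∈ H.plus, u i ^ 2 ≤ t i
  minus : ∀ i ∈ H.minus, t i ≤ u i ^ 2
  mem_Icc : ∀ i, u i ∈ Set.Icc (0 : ℝ) 1

/-- The points whose restrictions to the variables of `H` generate `PP H`, see
`PP_eq_image_domRestrict`. -/
def feasibleSet : Set (LiftedVar V → ℝ) := {w | ∃ u t, H.Feasible u t ∧ lift u t = w}

variable {H} in
theorem exists_feasible_domRestrict_lift_eq {z : H.vars → ℝ}
    (hplus : ∀ (i : V) (hi : i ∈ H.plus),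
      z (H.nodeVar i (H.plus_subset hi)) ^ 2 ≤ z (H.plusVar i hi))
    (hminus : ∀ (i : V) (hi : i ∈ H.minus),
      z (H.minusVar i hi) ≤ z (H.nodeVar i (H.minus_subset hi)) ^ 2)
    (hedge : ∀ (e : Finset V) (he : e ∈ H.edges),
      z (H.edgeVar e he) = ∏ i ∈ e.attach, z (H.nodeVar i.1 (H.edge_subset e he i.2)))
    (hnode : ∀ (i : V) (hi : i ∈ H.nodes), z (H.nodeVar i hi) ∈ Set.Icc (0 : ℝ) 1) :
    ∃ u t, H.Feasible u t ∧ H.vars.domRestrict (lift u t) = z := by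
  let w : LiftedVar V → ℝ := Function.extend Subtype.val z 0
  have w_eq : ∀ v : H.vars, w v = z v := Subtype.val_injective.extend_apply z 0
  have node_eq : ∀ i (hi : i ∈ H.nodes), w (node i) = z (H.nodeVar i hi) :=
    fun i hi => w_eq (H.nodeVar i hi)
  have plus_eq : ∀ i (hi : i ∈ H.plus), w (loop i) = z (H.plusVar i hi) :=
    fun i hi => w_eq (H.plusVar i hi)
  have minus_eq : ∀ i (hi : i ∈ H.minus), w (loop i) = z (H.minusVar i hi) :=
    fun i hi => w_eq (H.minusVar i hi)
  refine ⟨fun i => w (node i), fun i => w (loop i), ⟨fun i hi => ?_, fun i hi => ?_, fun i => ?_⟩,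
    funext fun ⟨v, hv⟩ => ?_⟩
  · simpa only [node_eq i (H.plus_subset hi), plus_eq i hi] using hplus i hi
  · simpa only [node_eq i (H.minus_subset hi), minus_eq i hi] using hminus i hi
  · by_cases hi : i ∈ H.nodes
    · simpa only [node_eq i hi] using hnode i hi
    · have node_eq_zero : w (node i) = 0 :=
        Function.extend_apply' z (0 : LiftedVar V → ℝ) (node i) (by
          rintro ⟨⟨_, hv⟩, rfl⟩
          exact hi hv)
      simp [node_eq_zero]
  · cases v with
    | node i => exact node_eq i hv
    | edge e =>
      refine Eq.trans ?_ (hedge e hv).symm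
      exact (Finset.prod_attach e fun i => w (node i)).symm.trans
        (Finset.prod_congr rfl fun i _ => node_eq i (H.edge_subset e hv i.2))
    | loop i => exact w_eq ⟨loop i, hv⟩

theorem PP_eq_image_domRestrict : H.PP = H.vars.domRestrict '' convexHull ℝ H.feasibleSet := by
  let restrictVars : (LiftedVar V → ℝ) →ₗ[ℝ] (H.vars → ℝ) := LinearMap.funLeft ℝ ℝ Subtype.val
  refine Eq.trans ?_ (restrictVars.image_convexHull _).symm
  rw [PP]
  congr 1
  ext z
  constructor
  · rintro ⟨hplus, hminus, hedge, hnode⟩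
    obtain ⟨u, t, hut, rfl⟩ := exists_feasible_domRestrict_lift_eq hplus hminus hedge hnode
    exact ⟨lift u t, ⟨u, t, hut, rfl⟩, rfl⟩
  · rintro ⟨_, ⟨u, t, hut, rfl⟩, rfl⟩
    exact ⟨hut.plus, hut.minus, fun e _ => (Finset.prod_attach e u).symm,
      fun i _ => hut.mem_Icc i⟩

theorem convex_PP : Convex ℝ H.PP := convex_convexHull ℝ _

variable {H} in
theorem edge_empty_eq_one {w : LiftedVar V → ℝ} (hw : w ∈ convexHull ℝ H.feasibleSet) :
    w (edge ∅) = 1 := by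
  have hconv : Convex ℝ {w : LiftedVar V → ℝ | w (edge ∅) = 1} :=
    convex_hyperplane (LinearMap.proj (edge ∅)).isLinear 1
  refine convexHull_min ?_ hconv hw
  rintro _ ⟨u, t, -, rfl⟩
  exact Finset.prod_empty

variable {H} in
theorem edge_singleton_eq_node {w : LiftedVar V → ℝ} (hw : w ∈ convexHull ℝ H.feasibleSet)
    (i : V) : w (edge {i}) = w (node i) := by
  let edgeCoord : (LiftedVar V → ℝ) →ₗ[ℝ] ℝ := LinearMap.proj (edge {i})
  refine convexHull_min ?_ (LinearMap.eqLocus edgeCoord (LinearMap.proj (node i))).convex hw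
  rintro _ ⟨u, t, -, rfl⟩
  exact Finset.prod_singleton u i

end PP

section Rounding

variable {V : Type*} {H : LoopHypergraph V}

theorem Feasible.update [DecidableEq V] {u t : V → ℝ} (h : H.Feasible u t) {i : V}
    (hi : i ∉ H.plus) {b s : ℝ} (hb : b ∈ Set.Icc (0 : ℝ) 1)
    (hs : i ∈ H.minus → s ≤ b ^ 2) :
    H.Feasible (Function.update u i b) (Function.update t i s) where
  plus j hj := by
    have hji : j ≠ i := fun hji => hi (hji ▸ hj)
    simpa only [Function.update_of_ne hji] using h.plus j hj
  minus j hj := by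
    rcases eq_or_ne j i with rfl | hji
    · simpa only [Function.update_self] using hs hj
    · simpa only [Function.update_of_ne hji] using h.minus j hj
  mem_Icc j := by
    rcases eq_or_ne j i with rfl | hji
    · simpa only [Function.update_self] using hb
    · simpa only [Function.update_of_ne hji] using h.mem_Icc j

/-- The feasible points with values `0` or `1` at the nodes of `U`. -/
def binarySet (H : LoopHypergraph V) (U : Finset V) : Set (LiftedVar V → ℝ) :=
  {w | ∃ u t, H.Feasible u t ∧ (∀ i ∈ U, u i = 0 ∨ u i = 1) ∧ lift u t = w}

theorem binarySet_subset_convexHull_binarySet_insert [DecidableEq V] {i : V} (hi : i ∉ H.plus)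
    (U : Finset V) :
    H.binarySet U ⊆ convexHull ℝ (H.binarySet (insert i U)) := by
  rintro _ ⟨u, t, h, hbin, rfl⟩
  obtain ⟨hu0, hu1⟩ := h.mem_Icc i
  have loop_le_node : i ∈ H.minus → t i ≤ u i := fun hm =>
    (h.minus i hm).trans (pow_le_of_le_one hu0 hu1 two_ne_zero)
  have update_mem : ∀ b s : ℝ, (b = 0 ∨ b = 1) → (i ∈ H.minus → s ≤ b ^ 2) →
      lift (Function.update u i b) (Function.update t i s) ∈
        convexHull ℝ (H.binarySet (insert i U)) := by
    intro b s hb hs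
    refine subset_convexHull ℝ _ ⟨_, _, h.update hi ?_ hs, fun j hj => ?_, rfl⟩
    · rcases hb with rfl | rfl <;> simp
    · rcases eq_or_ne j i with rfl | hji
      · simpa only [Function.update_self] using hb
      · simpa only [Function.update_of_ne hji] using hbin j (Finset.mem_of_mem_insert_of_ne hj hji)
  rw [lift_eq_add_lift_update u t i]
  refine convex_convexHull ℝ _ (update_mem 0 _ (Or.inl rfl) fun hm => ?_)
    (update_mem 1 _ (Or.inr rfl) fun hm => ?_) (sub_nonneg.2 hu1) hu0 (sub_add_cancel 1 _) <;>
  linarith [loop_le_node hm]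

theorem feasibleSet_subset_convexHull_binarySet {U : Finset V} (hU : Disjoint U H.plus) :
    H.feasibleSet ⊆ convexHull ℝ (H.binarySet U) := by
  classical
  induction U using Finset.induction_on with
  | empty =>
    rintro _ ⟨u, t, h, rfl⟩
    exact subset_convexHull ℝ _ ⟨u, t, h, by simp, rfl⟩
  | insert i U _ ih =>
    rw [Finset.disjoint_insert_left] at hU
    exact (ih hU.2).trans (convexHull_min (binarySet_subset_convexHull_binarySet_insert hU.1 U)
      (convex_convexHull ℝ _))

variable [DecidableEq V]

/-- The nodes without a plus loop, the ones whose values can be rounded to `0` or `1`. -/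
def freeNodes (H : LoopHypergraph V) : Finset V := H.nodes \ H.plus

/-- The feasible points whose values at the free nodes are given by the indicator function
of `y`. -/
def roundedSet (H : LoopHypergraph V) (y : Finset V) : Set (LiftedVar V → ℝ) :=
  {w | ∃ u t, H.Feasible u t ∧ (∀ i ∈ H.freeNodes, u i = if i ∈ y then 1 else 0) ∧ lift u t = w}

theorem roundedSet_nonempty (H : LoopHypergraph V) (y : Finset V) : (H.roundedSet y).Nonempty := by
  refine ⟨_, fun i => if i ∈ y then 1 else 0, fun i => (if i ∈ y then 1 else 0) ^ 2,
    ⟨fun _ _ => le_rfl, fun _ _ => le_rfl, fun i => ?_⟩, fun _ _ => rfl, rfl⟩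
  split_ifs <;> simp

theorem roundedSet_inter_freeNodes (H : LoopHypergraph V) (x : Finset V) :
    H.roundedSet (x ∩ H.freeNodes) = H.roundedSet x := by
  ext w
  refine exists₂_congr fun u t => and_congr_right fun _ => and_congr_left fun _ =>
    forall₂_congr fun i hi => ?_
  simp only [Finset.mem_inter, hi, and_true]

theorem edge_eq_ite_of_mem_convexHull_roundedSet {w : LiftedVar V → ℝ} {y T : Finset V}
    (hw : w ∈ convexHull ℝ (H.roundedSet y)) (hT : T ⊆ H.freeNodes) :
    w (edge T) = if T ⊆ y then 1 else 0 := by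
  have hconv : Convex ℝ {w : LiftedVar V → ℝ | w (edge T) = if T ⊆ y then 1 else 0} :=
    convex_hyperplane (LinearMap.proj (edge T)).isLinear _
  refine convexHull_min ?_ hconv hw
  rintro _ ⟨u, t, -, hu, rfl⟩
  change ∏ i ∈ T, u i = _
  rw [Finset.prod_congr rfl fun i hi => hu i (hT hi), Finset.prod_ite_zero]
  simp [Finset.subset_iff]

theorem sum_Icc_eq_edge {a : Finset V → ℝ} {p : Finset V → LiftedVar V → ℝ}
    (hp : ∀ y ∈ H.freeNodes.powerset, p y ∈ convexHull ℝ (H.roundedSet y)) {T : Finset V}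
    (hT : T ⊆ H.freeNodes) :
    ∑ y ∈ Finset.Icc T H.freeNodes, a y = (∑ y ∈ H.freeNodes.powerset, a y • p y) (edge T) := by
  rw [Finset.Icc_eq_filter_powerset, Finset.sum_filter, Finset.sum_apply]
  refine Finset.sum_congr rfl fun y hy => ?_
  simp [edge_eq_ite_of_mem_convexHull_roundedSet (hp y hy) hT]

theorem binarySet_freeNodes_subset :
    H.binarySet H.freeNodes ⊆ ⋃ y ∈ H.freeNodes.powerset, H.roundedSet y := by
  rintro _ ⟨u, t, h, hbin, rfl⟩
  refine Set.mem_biUnion (x := H.freeNodes.filter (u · = 1))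
    (Finset.mem_powerset.2 (Finset.filter_subset _ _)) ⟨u, t, h, fun i hi => ?_, rfl⟩
  rcases hbin i hi with hui | hui <;> simp [hui, hi]

theorem convexHull_feasibleSet_subset_mixtures :
    convexHull ℝ H.feasibleSet ⊆
      mixtures ℝ H.freeNodes.powerset fun y => convexHull ℝ (H.roundedSet y) := by
  refine Set.Subset.trans ?_
    (convexHull_biUnion_subset_mixtures fun y _ => H.roundedSet_nonempty y)
  exact convexHull_min ((feasibleSet_subset_convexHull_binarySet Finset.sdiff_disjoint).trans
    (convexHull_mono binarySet_freeNodes_subset)) (convex_convexHull ℝ _)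

end Rounding

section Gluing

variable {V I : Type*} [DecidableEq V]

/-- The hypergraphs `H c` cover `G` and overlap only in free nodes, every set of at least two free
nodes of `H c` is an edge of `H c`, and `H o` contains the free nodes of all of them. -/
structure IsGluing (G : LoopHypergraph V) (H : I → LoopHypergraph V) (o : I) : Prop where
  plus_subset : ∀ c, (H c).plus ⊆ G.plus
  minus_subset : ∀ c, (H c).minus ⊆ G.minus
  vars_subset : G.vars ⊆ ⋃ c, (H c).vars
  eq_of_mem_plus : ∀ c, ∀ i ∈ (H c).plus, ∀ c', i ∈ (H c').nodes → c' = c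
  freeNodes_subset : ∀ c, (H c).freeNodes ⊆ (H o).freeNodes
  mem_edges : ∀ c, ∀ T ⊆ (H c).freeNodes, T.Nontrivial → T ∈ (H c).edges

/-- The linear map that takes the value of the variable `v` of `G` from the point of the hypergraph
numbered `owner v`. -/
def glue (G : LoopHypergraph V) (owner : LiftedVar V → I) :
    (I → LiftedVar V → ℝ) →ₗ[ℝ] (G.vars → ℝ) where
  toFun w v := w (owner v) v
  map_add' _ _ := rfl
  map_smul' _ _ := rfl

namespace IsGluing

variable {G : LoopHypergraph V} {H : I → LoopHypergraph V} {o : I} {owner : LiftedVar V → I}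
  {w : I → LiftedVar V → ℝ}

theorem mem_plus_of_loop_mem_vars (h : IsGluing G H o) {c : I} {i : V} (hi : i ∈ G.plus)
    (hc : loop i ∈ (H c).vars) : i ∈ (H c).plus :=
  hc.resolve_right fun hm => Finset.disjoint_left.1 G.disjoint hi (h.minus_subset c hm)

theorem mem_minus_of_loop_mem_vars (h : IsGluing G H o) {c : I} {i : V} (hi : i ∈ G.minus)
    (hc : loop i ∈ (H c).vars) : i ∈ (H c).minus :=
  hc.resolve_left fun hp => Finset.disjoint_left.1 G.disjoint (h.plus_subset c hp) hi

theorem eq_or_mem_freeNodes (h : IsGluing G H o) {c c' : I} {i : V} (hi : i ∈ (H c).nodes)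
    (hi' : i ∈ (H c').nodes) : c = c' ∨ i ∈ (H c).freeNodes ∧ i ∈ (H c').freeNodes := by
  by_cases hp : i ∈ (H c).plus
  · exact Or.inl (h.eq_of_mem_plus c i hp c' hi').symm
  by_cases hp' : i ∈ (H c').plus
  · exact Or.inl (h.eq_of_mem_plus c' i hp' c hi)
  · exact Or.inr ⟨Finset.mem_sdiff.2 ⟨hi, hp⟩, Finset.mem_sdiff.2 ⟨hi', hp'⟩⟩

theorem glue_mem_PP_of_mem_roundedSet (h : IsGluing G H o)
    (howner : ∀ v ∈ G.vars, v ∈ (H (owner v)).vars) {x : Finset V}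
    (hw : ∀ c, w c ∈ (H c).roundedSet x) : glue G owner w ∈ G.PP := by
  choose u t hfeas hround hlift using hw
  have u_eq : ∀ {c i}, i ∈ G.nodes → i ∈ (H c).nodes → u (owner (node i)) i = u c i := by
    intro c i hiG hi
    rcases h.eq_or_mem_freeNodes (howner (node i) hiG) hi with rfl | ⟨hfree, hfree'⟩
    · rfl
    · rw [hround _ i hfree, hround c i hfree']
  let U : V → ℝ := fun i => u (owner (node i)) i
  let T : V → ℝ := fun i => t (owner (loop i)) i
  have hUT : G.Feasible U T := by
    refine ⟨fun i hi => ?_, fun i hi => ?_, fun i => (hfeas _).mem_Icc i⟩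
    · have hplus := h.mem_plus_of_loop_mem_vars hi (howner (loop i) (Or.inl hi))
      have sq_le := (hfeas _).plus i hplus
      rwa [← u_eq (G.plus_subset hi) ((H _).plus_subset hplus)] at sq_le
    · have hminus := h.mem_minus_of_loop_mem_vars hi (howner (loop i) (Or.inr hi))
      have le_sq := (hfeas _).minus i hminus
      rwa [← u_eq (G.minus_subset hi) ((H _).minus_subset hminus)] at le_sq
  rw [PP_eq_image_domRestrict]
  refine ⟨lift U T, subset_convexHull ℝ _ ⟨U, T, hUT, rfl⟩, funext fun ⟨v, hv⟩ => ?_⟩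
  change lift U T v = w (owner v) v
  rw [← hlift]
  cases v with
  | node i => rfl
  | edge e =>
    exact Finset.prod_congr rfl fun i hi =>
      u_eq (G.edge_subset e hv hi) ((H _).edge_subset e (howner (edge e) hv) hi)
  | loop i => rfl

theorem glue_mem_PP_of_mem_convexHull_roundedSet [Finite I] (h : IsGluing G H o)
    (howner : ∀ v ∈ G.vars, v ∈ (H (owner v)).vars) {x : Finset V}
    (hw : ∀ c, w c ∈ convexHull ℝ ((H c).roundedSet x)) : glue G owner w ∈ G.PP := by
  have rounded_subset : (Set.univ.pi fun c => (H c).roundedSet x) ⊆ glue G owner ⁻¹' G.PP :=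
    fun _ hf => h.glue_mem_PP_of_mem_roundedSet howner fun c => hf c trivial
  exact convexHull_min rounded_subset (G.convex_PP.linear_preimage (glue G owner))
    (mem_convexHull_pi fun c _ => hw c)

theorem edge_eq_edge (h : IsGluing G H o) (hw : ∀ c, w c ∈ convexHull ℝ (H c).feasibleSet)
    (hagree : ∀ c c' v, v ∈ (H c).vars → v ∈ (H c').vars → w c v = w c' v) {c : I}
    {T : Finset V} (hT : T ⊆ (H c).freeNodes) : w c (edge T) = w o (edge T) := by
  have hTo := hT.trans (h.freeNodes_subset c)
  rcases T.eq_empty_or_nonempty with rfl | hne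
  · rw [edge_empty_eq_one (hw c), edge_empty_eq_one (hw o)]
  rcases hne.exists_eq_singleton_or_nontrivial with ⟨i, rfl⟩ | hnt
  · rw [Finset.singleton_subset_iff] at hT hTo
    rw [edge_singleton_eq_node (hw c), edge_singleton_eq_node (hw o)]
    exact hagree c o (node i) (Finset.mem_sdiff.1 hT).1 (Finset.mem_sdiff.1 hTo).1
  · exact hagree c o (edge T) (h.mem_edges c T hT hnt) (h.mem_edges o T hTo hnt)

theorem mem_mixtures (h : IsGluing G H o) (hw : ∀ c, w c ∈ convexHull ℝ (H c).feasibleSet)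
    (hagree : ∀ c c' v, v ∈ (H c).vars → v ∈ (H c').vars → w c v = w c' v) :
    w ∈ mixtures ℝ (H o).freeNodes.powerset
      fun x => Set.univ.pi fun c => convexHull ℝ ((H c).roundedSet x) := by
  choose a p ha ha1 hp hsum using fun c => convexHull_feasibleSet_subset_mixtures (hw c)
  have sum_Icc_eq : ∀ c, ∀ T ⊆ (H c).freeNodes, ∑ y ∈ Finset.Icc T (H c).freeNodes, a c y =
      ∑ x ∈ Finset.Icc T (H o).freeNodes, a o x := by
    intro c T hT
    rw [sum_Icc_eq_edge (hp c) hT, sum_Icc_eq_edge (hp o) (hT.trans (h.freeNodes_subset c)),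
      hsum c, hsum o, h.edge_eq_edge hw hagree hT]
  refine ⟨a o, fun x c => p c (x ∩ (H c).freeNodes), ha o, ha1 o, fun x _ c _ => ?_,
    funext fun c => ?_⟩
  · change p c (x ∩ (H c).freeNodes) ∈ convexHull ℝ ((H c).roundedSet x)
    rw [← roundedSet_inter_freeNodes]
    exact hp c _ (Finset.mem_powerset.2 Finset.inter_subset_right)
  · rw [← hsum c, sum_powerset_smul_eq_sum_powerset_smul_inter (sum_Icc_eq c) (p c),
      Finset.sum_apply]
    rfl

theorem glue_mem_PP [Finite I] (h : IsGluing G H o)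
    (howner : ∀ v ∈ G.vars, v ∈ (H (owner v)).vars)
    (hw : ∀ c, w c ∈ convexHull ℝ (H c).feasibleSet)
    (hagree : ∀ c c' v, v ∈ (H c).vars → v ∈ (H c').vars → w c v = w c' v) :
    glue G owner w ∈ G.PP := by
  refine mixtures_subset (G.convex_PP.linear_preimage (glue G owner)) (fun x _ p hp => ?_)
    (h.mem_mixtures hw hagree)
  exact h.glue_mem_PP_of_mem_convexHull_roundedSet howner fun c => hp c trivial

theorem feasibleSet_subset (h : IsGluing G H o) (c : I) : G.feasibleSet ⊆ (H c).feasibleSet := by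
  rintro _ ⟨u, t, hut, rfl⟩
  exact ⟨u, t, ⟨fun i hi => hut.plus i (h.plus_subset c hi),
    fun i hi => hut.minus i (h.minus_subset c hi), hut.mem_Icc⟩, rfl⟩

theorem isExtendedFormulation_jointSet_PP [Finite I] (h : IsGluing G H o) :
    IsExtendedFormulation (Set.embeddingOfSubset _ _ h.vars_subset)
      (jointSet H fun c => (H c).PP) G.PP := by
  refine ⟨convex_jointSet fun c => (H c).convex_PP, Set.ext fun x => ⟨fun hx => ?_, ?_⟩⟩
  · rw [PP_eq_image_domRestrict] at hx
    obtain ⟨w, hw, rfl⟩ := hx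
    refine ⟨fun v => w v, fun c => ?_, fun _ => rfl⟩
    change _ ∈ (H c).PP
    rw [PP_eq_image_domRestrict]
    exact ⟨w, convexHull_mono (h.feasibleSet_subset c) hw, rfl⟩
  · rintro ⟨z, hz, hzx⟩
    have exists_w : ∀ c, ∃ w ∈ convexHull ℝ (H c).feasibleSet, ∀ (v : LiftedVar V)
        (hv : v ∈ (H c).vars), w v = z ⟨v, Set.mem_iUnion_of_mem c hv⟩ := by
      intro c
      have hzc : _ ∈ (H c).PP := hz c
      rw [PP_eq_image_domRestrict] at hzc
      obtain ⟨w, hw, hwz⟩ := hzc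
      exact ⟨w, hw, fun v hv => congrFun hwz ⟨v, hv⟩⟩
    choose w hw hwz using exists_w
    have exists_owner : ∀ v ∈ G.vars, ∃ c, v ∈ (H c).vars :=
      fun v hv => Set.mem_iUnion.1 (h.vars_subset hv)
    have : Nonempty I := ⟨o⟩
    choose! owner howner using exists_owner
    have x_eq : x = glue G owner w :=
      funext fun v => (hzx v).symm.trans (hwz (owner v) v (howner v v.2)).symm
    rw [x_eq]
    exact h.glue_mem_PP howner hw fun c c' v hv hv' => (hwz c v hv).trans (hwz c' v hv').symm

end IsGluing

/-- The part of `G` induced by `S`, in which moreover all sets of at least two nodes without plus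
loop are made edges. -/
def inducedCompletion (G : LoopHypergraph V) (S : Finset V) : LoopHypergraph V where
  nodes := S
  edges := {e | e ⊆ S ∧ 2 ≤ e.card ∧ (e ∈ G.edges ∨ Disjoint e G.plus)}
  plus := G.plus ∩ S
  minus := G.minus ∩ S
  edge_subset _ he := he.1
  two_le_card _ he := he.2.1
  plus_subset := Finset.inter_subset_right
  minus_subset := Finset.inter_subset_right
  disjoint := G.disjoint.mono Finset.inter_subset_left Finset.inter_subset_left

theorem freeNodes_inducedCompletion (G : LoopHypergraph V) (S : Finset V) :
    (G.inducedCompletion S).freeNodes = S \ G.plus := by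
  change S \ (G.plus ∩ S) = S \ G.plus
  rw [Finset.inter_comm, Finset.sdiff_inter_self_left]

theorem isGluing_inducedCompletion {G : LoopHypergraph V} {S : I → Finset V} {o : I}
    (hnodes : ∀ i ∈ G.nodes, ∃ c, i ∈ S c) (hedges : ∀ e ∈ G.edges, ∃ c, e ⊆ S c)
    (hplus : ∀ i ∈ G.plus, ∀ c c', i ∈ S c → i ∈ S c' → c = c')
    (hfree : ∀ c, S c \ G.plus ⊆ S o) :
    G.IsGluing (fun c => G.inducedCompletion (S c)) o where
  plus_subset _ := Finset.inter_subset_left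
  minus_subset _ := Finset.inter_subset_left
  vars_subset v hv := by
    rw [Set.mem_iUnion]
    cases v with
    | node i => exact hnodes i hv
    | edge e =>
      obtain ⟨c, hc⟩ := hedges e hv
      exact ⟨c, hc, G.two_le_card e hv, Or.inl hv⟩
    | loop i =>
      obtain ⟨c, hc⟩ := hnodes i (hv.elim (G.plus_subset ·) (G.minus_subset ·))
      exact ⟨c, hv.imp (Finset.mem_inter_of_mem · hc) (Finset.mem_inter_of_mem · hc)⟩
  eq_of_mem_plus c i hi c' hi' :=
    hplus i (Finset.mem_inter.1 hi).1 c' c hi' (Finset.mem_inter.1 hi).2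
  freeNodes_subset c := by
    rw [freeNodes_inducedCompletion, freeNodes_inducedCompletion]
    exact Finset.subset_sdiff.2 ⟨hfree c, Finset.sdiff_disjoint⟩
  mem_edges c T hT hcard := by
    rw [freeNodes_inducedCompletion, Finset.subset_sdiff] at hT
    exact ⟨hT.1, Finset.one_lt_card_iff_nontrivial.2 hcard, Or.inr hT.2⟩

end Gluing

end LoopHypergraph

namespace LoopGraph

section Components

variable {V : Type*} (G : LoopGraph V)

theorem iUnion_compNodes : ⋃ c, G.compNodes c = G.plus := by
  simp only [compNodes]
  rw [← Set.image_iUnion, SimpleGraph.iUnion_connectedComponentSupp, Set.image_univ,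
    Subtype.range_coe]

theorem pairwise_disjoint_compNodes : Pairwise (Function.onFun Disjoint G.compNodes) :=
  fun _ _ hcc' => (Set.disjoint_image_iff Subtype.val_injective).2
    (SimpleGraph.pairwise_disjoint_supp_connectedComponent _ hcc')

theorem finsum_ncard_compNodes [Finite V] : ∑ᶠ c, (G.compNodes c).ncard = G.plus.card := by
  rw [← Set.ncard_iUnion_of_finite (fun _ => Set.toFinite _) G.pairwise_disjoint_compNodes,
    iUnion_compNodes, Set.ncard_coe_finset]

theorem compNodes_subset_plus (c : G.PlusComponent) : G.compNodes c ⊆ G.plus :=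
  Subtype.coe_image_subset _ _

variable {G}

theorem exists_mem_compNodes {i : V} (hi : i ∈ G.plus) : ∃ c, i ∈ G.compNodes c := by
  rwa [← Set.mem_iUnion, iUnion_compNodes]

theorem mem_compNodes_of_adj {c : G.PlusComponent} {i j : V} (hi : i ∈ G.compNodes c)
    (hij : G.graph.Adj i j) (hj : j ∈ G.plus) : j ∈ G.compNodes c := by
  obtain ⟨i', hi', rfl⟩ := hi
  exact ⟨⟨j, hj⟩, c.mem_supp_of_adj_mem_supp hi' hij, rfl⟩

theorem disjoint_plus_neighborhood_compNodes (c : G.PlusComponent) :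
    Disjoint (G.plus : Set V) (G.neighborhood (G.compNodes c)) :=
  Set.disjoint_left.2 fun _ hi ⟨hic, _, hj, hij⟩ => hic (mem_compNodes_of_adj hj hij.symm hi)

theorem mem_union_neighborhood_of_adj {S : Set V} {i j : V} (hi : i ∈ S)
    (hij : G.graph.Adj i j) : j ∈ S ∪ G.neighborhood S :=
  (em (j ∈ S)).imp_right fun hj => ⟨hj, i, hi, hij.symm⟩

variable (G) in
theorem disjoint_neighborhood (S : Set V) : Disjoint S (G.neighborhood S) :=
  Set.disjoint_left.2 fun _ hi hn => hn.1 hi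

end Components

section Pieces

variable {V : Type*} [Fintype V] [DecidableEq V] (G : LoopGraph V)

theorem QP_eq_PP_toHypergraph : G.QP = G.toHypergraph.PP := by
  rw [QP, LoopHypergraph.PP]
  congr 1
  ext z
  have prod_attach_pair {i j : V} (hij : G.graph.Adj i j) :
      ∏ k ∈ ({i, j} : Finset V).attach, z (G.toHypergraph.nodeVar k (Finset.mem_univ k.1)) =
        z (G.toHypergraph.nodeVar i (Finset.mem_univ i)) *
          z (G.toHypergraph.nodeVar j (Finset.mem_univ j)) := by
    rw [Finset.prod_attach ({i, j} : Finset V)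
      (fun k => z (G.toHypergraph.nodeVar k (Finset.mem_univ k))), Finset.prod_pair hij.ne]
  refine and_congr_right fun _ => and_congr_right fun _ => and_congr ⟨?_, ?_⟩ ⟨?_, ?_⟩
  · rintro h _ ⟨i, j, hij, rfl⟩
    exact (h i j hij).trans (prod_attach_pair hij).symm
  · exact fun h i j hij => (h _ ⟨i, j, hij, rfl⟩).trans (prod_attach_pair hij)
  · exact fun h i _ => h i
  · exact fun h i => h i (Finset.mem_univ i)

/-- The node sets of the pieces of the decomposition: a component of the plus-loop nodes together
with its neighbours, for `some c`, and the nodes without plus loop, for `none`. -/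
noncomputable def pieceNodes : Option G.PlusComponent → Finset V
  | some c => (Set.toFinite (G.compNodes c ∪ G.neighborhood (G.compNodes c))).toFinset
  | none => Finset.univ \ G.plus

variable {G}

theorem coe_pieceNodes_some (c : G.PlusComponent) :
    (G.pieceNodes (some c) : Set V) = G.compNodes c ∪ G.neighborhood (G.compNodes c) :=
  Set.Finite.coe_toFinset _

theorem mem_pieceNodes_none {i : V} : i ∈ G.pieceNodes none ↔ i ∉ G.plus :=
  Finset.mem_sdiff.trans (and_iff_right (Finset.mem_univ i))

theorem card_pieceNodes_some (c : G.PlusComponent) :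
    (G.pieceNodes (some c)).card =
      (G.compNodes c).ncard + (G.neighborhood (G.compNodes c)).ncard := by
  rw [← Set.ncard_coe_finset, coe_pieceNodes_some, Set.ncard_union_eq (G.disjoint_neighborhood _)]

variable (G) in
theorem card_pieceNodes_none_add_finsum_ncard_compNodes :
    (G.pieceNodes none).card + ∑ᶠ c, (G.compNodes c).ncard = Fintype.card V := by
  rw [finsum_ncard_compNodes]
  exact Finset.card_sdiff_add_card_eq_card (Finset.subset_univ G.plus)

theorem coe_plus_inter_pieceNodes_some (c : G.PlusComponent) :
    ((G.plus ∩ G.pieceNodes (some c) : Finset V) : Set V) = G.compNodes c := by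
  rw [Finset.coe_inter, coe_pieceNodes_some, Set.inter_union_distrib_left,
    (disjoint_plus_neighborhood_compNodes c).inter_eq, Set.union_empty,
    Set.inter_eq_right.2 (G.compNodes_subset_plus c)]

theorem exists_mem_pieceNodes (i : V) : ∃ c, i ∈ G.pieceNodes c := by
  by_cases hi : i ∈ G.plus
  · obtain ⟨c, hc⟩ := exists_mem_compNodes hi
    exact ⟨some c, (coe_pieceNodes_some c).ge (Or.inl hc)⟩
  · exact ⟨none, mem_pieceNodes_none.2 hi⟩

theorem exists_pair_subset_pieceNodes {i j : V} (hij : G.graph.Adj i j) :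
    ∃ c, {i, j} ⊆ G.pieceNodes c := by
  wlog hi : i ∈ G.plus generalizing i j
  · by_cases hj : j ∈ G.plus
    · rw [Finset.pair_comm]
      exact this hij.symm hj
    · exact ⟨none, Finset.insert_subset (mem_pieceNodes_none.2 hi)
        (Finset.singleton_subset_iff.2 (mem_pieceNodes_none.2 hj))⟩
  obtain ⟨c, hc⟩ := exists_mem_compNodes hi
  exact ⟨some c, Finset.insert_subset ((coe_pieceNodes_some c).ge (Or.inl hc))
    (Finset.singleton_subset_iff.2
      ((coe_pieceNodes_some c).ge (mem_union_neighborhood_of_adj hc hij)))⟩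

theorem eq_of_mem_pieceNodes {i : V} (hi : i ∈ G.plus) {c c' : Option G.PlusComponent}
    (hc : i ∈ G.pieceNodes c) (hc' : i ∈ G.pieceNodes c') : c = c' := by
  have mem_compNodes {c : G.PlusComponent} (hc : i ∈ G.pieceNodes (some c)) : i ∈ G.compNodes c :=
    (coe_plus_inter_pieceNodes_some c).le (Finset.mem_inter_of_mem hi hc)
  rcases c with _ | c
  · exact absurd hi (mem_pieceNodes_none.1 hc)
  rcases c' with _ | c'
  · exact absurd hi (mem_pieceNodes_none.1 hc')
  · exact congrArg some (G.pairwise_disjoint_compNodes.eq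
      (Set.not_disjoint_iff.2 ⟨i, mem_compNodes hc, mem_compNodes hc'⟩))

variable (G)

/-- The hypergraphs `G'_c` of the theorem, where `none` stands for the index `0`. -/
noncomputable def piece (c : Option G.PlusComponent) : LoopHypergraph V :=
  G.toHypergraph.inducedCompletion (G.pieceNodes c)

theorem plus_piece_none : (G.piece none).plus = ∅ :=
  Finset.inter_sdiff_self G.plus Finset.univ

theorem minus_piece_none : (G.piece none).minus = G.minus :=
  Finset.inter_eq_left.2 fun _ hi => mem_pieceNodes_none.2 (Finset.disjoint_right.1 G.disjoint hi)

theorem card_plus_piece_some (c : G.PlusComponent) :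
    (G.piece (some c)).plus.card = (G.compNodes c).ncard := by
  rw [← Set.ncard_coe_finset]
  exact congrArg Set.ncard (coe_plus_inter_pieceNodes_some c)

theorem isGluing_piece : G.toHypergraph.IsGluing G.piece none :=
  LoopHypergraph.isGluing_inducedCompletion (fun i _ => exists_mem_pieceNodes i)
    (by
      rintro _ ⟨i, j, hij, rfl⟩
      exact exists_pair_subset_pieceNodes hij)
    (fun _ hi _ _ => eq_of_mem_pieceNodes hi)
    fun _ _ hi => mem_pieceNodes_none.2 (Finset.mem_sdiff.1 hi).2

end Pieces

end LoopGraph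

theorem mainTheorem9 {V : Type*} [Fintype V] [DecidableEq V] (G : LoopGraph V) :
    ∃ H : Option G.PlusComponent → LoopHypergraph V,
      (∀ c : G.PlusComponent,
        ((H (some c)).nodes : Set V) = G.compNodes c ∪ G.neighborhood (G.compNodes c) ∧
        ((H (some c)).plus : Set V) = G.compNodes c ∧
        (H (some c)).minus = G.minus ∩ (H (some c)).nodes ∧
        (H (some c)).nodes.card =
          (G.compNodes c).ncard + (G.neighborhood (G.compNodes c)).ncard ∧
        (H (some c)).plus.card = (G.compNodes c).ncard) ∧
      ((H none).nodes = Finset.univ \ G.plus ∧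
        (H none).plus = ∅ ∧
        (H none).minus = G.minus ∧
        (H none).nodes.card + ∑ᶠ c : G.PlusComponent, (G.compNodes c).ncard = Fintype.card V) ∧
      ∃ hG : G.vars ⊆ ⋃ c, (H c).vars,
        ∀ (r : Option G.PlusComponent → ℕ)
          (Q : ∀ c, Set ((H c).vars ⊕ Fin (r c) → ℝ)),
          (∀ c, IsExtendedFormulation Function.Embedding.inl (Q c) (H c).PP) →
          IsExtendedFormulation
            ((Set.embeddingOfSubset _ _ hG).trans Function.Embedding.inl)
            (putTogether H r Q) G.QP := by
  refine ⟨G.piece, fun c => ⟨LoopGraph.coe_pieceNodes_some c,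
    LoopGraph.coe_plus_inter_pieceNodes_some c, rfl, LoopGraph.card_pieceNodes_some c,
    G.card_plus_piece_some c⟩, ⟨rfl, G.plus_piece_none, G.minus_piece_none,
    G.card_pieceNodes_none_add_finsum_ncard_compNodes⟩, G.isGluing_piece.vars_subset,
    fun r Q hQ => ?_⟩
  rw [G.QP_eq_PP_toHypergraph]
  exact G.isGluing_piece.isExtendedFormulation_jointSet_PP.trans
    (isExtendedFormulation_putTogether hQ)
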